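/- Let $\mathcal G$ be a simple graph with finite vertex set $V$, let $K$ be a field, $R=K[x_v : v\in V]$, $\mathfrak m=\langle x_v : v\in V\rangle$, and let $I(\mathcal G)\subseteq R$ be the edge ideal, generated by all $x_ix_j$ with $\{i,j\}$ an edge. Let $G(I)$ denote the set of minimal monomial generators of a monomial ideal $I$. Given a total order $\prec$ on $G(I)$, with $m_1\prec\cdots\prec m_\mu$, the Lyubeznik resolution of $R/I$ is the following subcomplex of the Taylor complex. Its term $L^t$ is the free $R$-module on the symbols $u(i_1;\dots;i_t)$, $i_1<\cdots<i_t$, such that $m_q\nmid \mathrm{lcm}(m_{i_h},\dots,m_{i_t})$ for all $h<t$ and $q<i_h$. Its differential is $$\partial u(i_1;\dots;i_t)=\sum_{j=1}^t(-1)^{j+1}\frac{\mathrm{lcm}(m_{i_1},\dots,m_{i_t})}{\mathrm{lcm}(m_{i_1},\dots,\widehat{m_{i_j}},\dots,m_{i_t})}\,u(i_1;\dots;\widehat{i_j};\dots;i_t),$$ with augmentation $L^0=R\to R/I$. It is a minimal free resolution of $R/I$ if the augmented complex is exact and $\partial(L^{t+1})\subseteq\mathfrak m L^{t}$ for all $t\ge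 0$. A monomial ideal $I$ is a Lyubeznik ideal if for some total order on $G(I)$ the Lyubeznik resolution of $R/I$ is a minimal free resolution of $R/I$. A set $C\subseteq G(I)$ is an $E$-minimal cover of $u\in C$ if $u\mid\mathrm{lcm}(C\setminus\{u\})$ and no proper subset of $C$ containing $u$ has this property. Proposition. Suppose that $\mathcal G$ has no path of length $\ge 4$, open or closed; that is, $\mathcal G$ contains neither a path (with distinct vertices) with at least $4$ edges nor a cycle with at least $4$ edges. Then $I(\mathcal G)$ is a Lyubeznik ideal. More precisely, there is a total order $\prec$ on $G(I(\mathcal G))$ such that $x_ix_j\prec x_rx_i$ and $x_ix_j\prec x_jx_s$ for every $E$-minimal cover $\{x_rx_i,x_ix_j,x_jx_s\}$ of $x_ix_j$ with $r\ne s$, and for every total order with this property the Lyubeznik resolution of $R/I(\mathcal G)$ is a minimal free resolution of $R/I(\mathcal G)$. -/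

import Mathlib

open MvPolynomial

noncomputable section

namespace Lyubeznik

variable {V K : Type*} [Field K]

/-- An ideal of `K[x_v : v ∈ V]` generated by monomials. -/
def IsMonomialIdeal (I : Ideal (MvPolynomial V K)) : Prop :=
  ∃ S : Set (V →₀ ℕ), I = Ideal.span ((fun m => monomial m (1 : K)) '' S)

/-- `G(I)`: the minimal monomial generators of a monomial ideal `I`, i.e. the monomials of `I` that
are minimal for divisibility. A monomial is recorded by its exponent vector, so divisibility is `≤`
and `lcm` is `⊔`. This is a type of its own, so that total orders on `G(I)` do not get mixed up with
the divisibility order. -/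
def MinGen (I : Ideal (MvPolynomial V K)) : Type _ :=
  {m : V →₀ ℕ // Minimal (fun m => monomial m (1 : K) ∈ I) m}

namespace MinGen

/-- The exponent vector of a minimal generator. -/
def exponent {I : Ideal (MvPolynomial V K)} (m : MinGen I) : V →₀ ℕ := m.1

end MinGen

variable {I : Ideal (MvPolynomial V K)}

/-- The exponent vector of `lcm(A)`. -/
def lcmExp (A : Finset (MinGen I)) : V →₀ ℕ := A.sup MinGen.exponent

theorem lcmExp_mono {A B : Finset (MinGen I)} (h : A ⊆ B) : lcmExp A ≤ lcmExp B :=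
  Finset.sup_mono h

open Classical in
/-- `C` is a cover of `u`: `u ∈ C` and `u` divides `lcm(C - {u})`. -/
def IsCover (u : MinGen I) (C : Finset (MinGen I)) : Prop :=
  u ∈ C ∧ u.exponent ≤ lcmExp (C.erase u)

/-- `C` is an `E`-minimal cover of `u`: it covers `u` and no proper subset of it does. -/
def IsEMinimalCover (u : MinGen I) (C : Finset (MinGen I)) : Prop :=
  IsCover u C ∧ ∀ D, D ⊂ C → ¬ IsCover u D

section Order

variable [LinearOrder (MinGen I)]

/-- The symbol `u(i₁; …; i_t)` given by the finite set `F = {m_{i₁} ≺ ⋯ ≺ m_{i_t}}` is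
`L`-admissible: `m_q` does not divide `lcm(m_{i_h}, …, m_{i_t})` for all `h < t` and `q < i_h`. -/
def IsAdmissible (F : Finset (MinGen I)) : Prop :=
  ∀ h ∈ F, (∃ i ∈ F, h < i) → ∀ q, q < h →
    ¬ q.exponent ≤ lcmExp (F.filter (fun i => h ≤ i))

theorem IsAdmissible.subset {F F' : Finset (MinGen I)} (hF : IsAdmissible F) (h : F' ⊆ F) :
    IsAdmissible F' := by
  rintro a ha ⟨i, hi, hai⟩ q hq hle
  exact hF a (h ha) ⟨i, h hi, hai⟩ q hq
    (hle.trans (lcmExp_mono (Finset.filter_subset_filter _ h)))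

end Order

/-- The `L`-admissible symbols of dimension `t`. -/
def Symb (I : Ideal (MvPolynomial V K)) [LinearOrder (MinGen I)] (t : ℕ) : Type _ :=
  {F : Finset (MinGen I) // IsAdmissible F ∧ F.card = t}

/-- The free module `L^t` on the `L`-admissible symbols of dimension `t`. For `t = 0` the only symbol
is the empty one, so that `L^0` is free of rank one. -/
abbrev LMod (I : Ideal (MvPolynomial V K)) [LinearOrder (MinGen I)] (t : ℕ) : Type _ :=
  Symb I t →₀ MvPolynomial V K

section Complex

variable [LinearOrder (MinGen I)]

/-- The symbol obtained by omitting one entry. -/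
def Symb.face {t : ℕ} (F : Symb I (t + 1)) (a : {a // a ∈ F.1}) : Symb I t :=
  ⟨F.1.erase a.1, F.2.1.subset (Finset.erase_subset _ _), by
    rw [Finset.card_erase_of_mem a.2, F.2.2]; rfl⟩

end Complex

/-- The differential `∂_{t+1} : L^{t+1} → L^t`,
`∂ F = ∑_j (-1)^(j+1) (lcm F / lcm (F - {m_{i_j}})) (F - {m_{i_j}})`. The entry `a` of `F` in position
`j` is preceded by `j - 1` entries of `F`. -/
def diff (I : Ideal (MvPolynomial V K)) [LinearOrder (MinGen I)] (t : ℕ) :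
    LMod I (t + 1) →ₗ[MvPolynomial V K] LMod I t :=
  Finsupp.linearCombination (MvPolynomial V K) fun F : Symb I (t + 1) =>
    ∑ a ∈ F.1.attach,
      Finsupp.single (F.face a)
        (monomial (lcmExp F.1 - lcmExp (F.face a).1)
          ((-1 : K) ^ (F.1.filter (fun b => b < a.1)).card))

/-- The augmentation `∂_0 : L^0 → R/I`, sending the empty symbol to `1`. -/
def aug (I : Ideal (MvPolynomial V K)) [LinearOrder (MinGen I)] :
    LMod I 0 →ₗ[MvPolynomial V K] (MvPolynomial V K ⧸ I) :=
  Finsupp.linearCombination (MvPolynomial V K) fun _ : Symb I 0 => (1 : MvPolynomial V K ⧸ I)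

/-- `⋯ → L 2 → L 1 → L 0 → M → 0` is a resolution of `M` by finitely generated free `R`-modules which
is minimal with respect to the ideal `𝔪`: each differential has its image in `𝔪 • L t`. -/
structure IsMinimalFreeResolution {R : Type*} [CommRing R] (𝔪 : Ideal R) {M : Type*}
    [AddCommGroup M] [Module R M] (L : ℕ → Type*) [∀ t, AddCommGroup (L t)] [∀ t, Module R (L t)]
    (d : ∀ t, L (t + 1) →ₗ[R] L t) (ε : L 0 →ₗ[R] M) : Prop where
  free : ∀ t, Module.Free R (L t)
  finite : ∀ t, Module.Finite R (L t)
  exact : ∀ t, Function.Exact (d (t + 1)) (d t)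
  exact_zero : Function.Exact (d 0) ε
  surjective : Function.Surjective ε
  minimal : ∀ t, LinearMap.range (d t) ≤ 𝔪 • (⊤ : Submodule R (L t))

/-- The Lyubeznik resolution of `R/I` with respect to the given total order on `G(I)` is a minimal
free resolution of `R/I`; here `𝔪 = ⟨x_v : v ∈ V⟩`. -/
def LyubeznikResolutionIsMinimal (I : Ideal (MvPolynomial V K)) [LinearOrder (MinGen I)] : Prop :=
  IsMinimalFreeResolution (Ideal.span (Set.range (X : V → MvPolynomial V K)))
    (LMod I) (diff I) (aug I)

/-- `I` is a Lyubeznik ideal: a monomial ideal for which some total order on `G(I)` makes the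
Lyubeznik resolution of `R/I` a minimal free resolution. -/
def IsLyubeznikIdeal (I : Ideal (MvPolynomial V K)) : Prop :=
  IsMonomialIdeal I ∧ ∃ _ : LinearOrder (MinGen I), LyubeznikResolutionIsMinimal I

/-- The edge ideal of a simple graph, generated by the `x_i x_j` with `{x_i, x_j}` an edge. -/
def edgeIdeal (K : Type*) [Field K] (G : SimpleGraph V) : Ideal (MvPolynomial V K) :=
  Ideal.span {f | ∃ i j, G.Adj i j ∧ f = X i * X j}

/-- The total order on the generators of the edge ideal puts the middle edge first in every
`E`-minimal cover of the form `{x_r x_i, x_i x_j, x_j x_s}` with `r ≠ s`. -/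
def MiddleEdgeFirst (K : Type*) [Field K] (G : SimpleGraph V)
    [LinearOrder (MinGen (edgeIdeal K G))] : Prop :=
  ∀ (r i j s : V) (a b c : MinGen (edgeIdeal K G)) (C : Finset (MinGen (edgeIdeal K G))), r ≠ s →
    a.exponent = Finsupp.single r 1 + Finsupp.single i 1 →
    b.exponent = Finsupp.single i 1 + Finsupp.single j 1 →
    c.exponent = Finsupp.single j 1 + Finsupp.single s 1 →
    (∀ x, x ∈ C ↔ x = a ∨ x = b ∨ x = c) → IsEMinimalCover b C → b < a ∧ b < c

end Lyubeznik

end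

/-! Exactness holds for any monomial ideal with finitely many minimal generators. In multidegree α
the complex is the augmented simplicial chain complex of the admissible sets whose lcm divides x^α.
If some generator divides x^α, the first such generator can be adjoined to every one of these sets,
so the complex is a cone and is contractible (`homotopy_symbTerm`).

Minimality fails only if an entry a = x_i x_j of an admissible set F divides the lcm of the others.
Then F contains edges b = ri and c = js. If r = s, each edge of this triangle divides the lcm of the
other two, and the first of them violates admissibility. If r ≠ s, {b, a, c} is an E-minimal cover
of a, so a precedes b and c, and again F is not admissible. This argument works for every finite
graph.

The path and cycle conditions give the order: they prevent an end edge of a three-edge path from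
being the middle edge of another (`IsMiddleEdge.not_isMiddleEdge`), so all middle edges can be
placed first. -/

noncomputable section

namespace Lyubeznik

variable {V K : Type*} [Field K]

/-! ### Monomial ideals and simplicial signs -/

section MonomialIdeal

variable {I : Ideal (MvPolynomial V K)}

theorem exponent_le_lcmExp {F : Finset (MinGen I)} {a : MinGen I} (ha : a ∈ F) :
    a.exponent ≤ lcmExp F :=
  Finset.le_sup (f := MinGen.exponent) ha

theorem exists_exponent_le {α : V →₀ ℕ} (h : monomial α (1 : K) ∈ I) :
    ∃ p : MinGen I, p.exponent ≤ α := by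
  obtain ⟨m, hm, hmin⟩ := exists_minimal_le_of_wellFoundedLT
    (fun m => monomial m (1 : K) ∈ I) α h
  exact ⟨⟨m, hmin⟩, hm⟩

theorem monomial_exponent_mem (p : MinGen I) : monomial p.exponent (1 : K) ∈ I := p.2.1

theorem monomial_mem_of_exponent_le {α : V →₀ ℕ} {p : MinGen I} (h : p.exponent ≤ α) (c : K) :
    monomial α c ∈ I := by
  have := I.mul_mem_left (monomial (α - p.exponent) c) (monomial_exponent_mem p)
  rwa [monomial_mul, tsub_add_cancel_of_le h, mul_one] at this

theorem IsMonomialIdeal.monomial_mem (hI : IsMonomialIdeal I) {f : MvPolynomial V K} (hf : f ∈ I)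
    {α : V →₀ ℕ} (hα : α ∈ f.support) : monomial α (1 : K) ∈ I := by
  obtain ⟨S, rfl⟩ := hI
  obtain ⟨s, hs, hle⟩ := mem_ideal_span_monomial_image.1 hf α hα
  rw [mem_ideal_span_monomial_image]
  intro x hx
  rw [Finset.mem_singleton.1 (support_monomial_subset hx)]
  exact ⟨s, hs, hle⟩

theorem monomial_mem_span_X {α : V →₀ ℕ} (hα : α ≠ 0) (c : K) :
    monomial α c ∈ Ideal.span (Set.range (X : V → MvPolynomial V K)) := by
  obtain ⟨v, hv⟩ := Finsupp.ne_iff.1 hα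
  have hle : Finsupp.single v 1 ≤ α := by
    rw [Finsupp.single_le_iff]
    exact Nat.one_le_iff_ne_zero.2 hv
  have := Ideal.mul_mem_left _ (monomial (α - Finsupp.single v 1) c)
    (Ideal.subset_span (Set.mem_range_self v) : X v ∈ Ideal.span (Set.range (X : V → _)))
  rwa [X, monomial_mul, tsub_add_cancel_of_le hle, mul_one] at this

theorem smul_one_quotient (f : MvPolynomial V K) :
    f • (1 : MvPolynomial V K ⧸ I) = Ideal.Quotient.mk I f :=
  congrArg (Ideal.Quotient.mk I) (mul_one f)

theorem card_filter_lt_erase_of_lt {α : Type*} [LinearOrder α] {F : Finset α} {a b : α}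
    (h : a < b) : ((F.erase b).filter (· < a)).card = (F.filter (· < a)).card := by
  congr 1
  ext x
  simp only [Finset.mem_filter, Finset.mem_erase]
  exact ⟨fun hx => ⟨hx.1.2, hx.2⟩, fun hx => ⟨⟨(hx.2.trans h).ne, hx.1⟩, hx.2⟩⟩

theorem card_filter_lt_erase_add_one {α : Type*} [LinearOrder α] {F : Finset α} {a b : α}
    (ha : a ∈ F) (h : a < b) :
    ((F.erase a).filter (· < b)).card + 1 = (F.filter (· < b)).card := by
  rw [Finset.filter_erase, Finset.card_erase_add_one]
  simp [ha, h]

/-- Erasing the smaller entry shifts the position of the larger by one, while erasing the larger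
leaves the smaller in place. -/
theorem sign_erase_swap {α : Type*} [LinearOrder α] {F : Finset α} {a b : α}
    (ha : a ∈ F) (h : a < b) :
    (-1 : K) ^ (F.filter (· < a)).card * (-1) ^ ((F.erase a).filter (· < b)).card +
      (-1) ^ (F.filter (· < b)).card * (-1) ^ ((F.erase b).filter (· < a)).card = 0 := by
  rw [card_filter_lt_erase_of_lt h, ← card_filter_lt_erase_add_one ha h]
  ring

/-! ### The Lyubeznik complex, one multidegree at a time -/

section Resolution

variable [LinearOrder (MinGen I)]

open Classical in
/-- The element of multidegree `α` of `L^t` supported on the symbol `F`, for `lcm F ∣ x^α`; it is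
zero if `F` is not an admissible symbol of dimension `t`. -/
def symbTerm (t : ℕ) (α : V →₀ ℕ) (F : Finset (MinGen I)) : LMod I t :=
  if h : IsAdmissible F ∧ F.card = t then
    Finsupp.single (⟨F, h⟩ : Symb I t) (monomial (α - lcmExp F) (1 : K))
  else 0

theorem symbTerm_of_symb {t : ℕ} (α : V →₀ ℕ) (F : Symb I t) :
    symbTerm t α F.1 = Finsupp.single F (monomial (α - lcmExp F.1) (1 : K)) :=
  dif_pos F.2

/-- The quotients of lcms are absorbed by the factor x^α / lcm F, leaving the simplicial boundary
with coefficients ±1. -/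
theorem diff_symbTerm {t : ℕ} {α : V →₀ ℕ} (F : Symb I (t + 1)) (hα : lcmExp F.1 ≤ α) :
    diff I t (symbTerm (t + 1) α F.1) =
      ∑ a ∈ F.1, (-1 : K) ^ (F.1.filter (· < a)).card • symbTerm t α (F.1.erase a) := by
  rw [symbTerm_of_symb, diff, Finsupp.linearCombination_single, Finset.smul_sum,
    ← Finset.sum_attach F.1]
  refine Finset.sum_congr rfl fun a _ => ?_
  have hle : lcmExp (F.face a).1 ≤ lcmExp F.1 := lcmExp_mono (Finset.erase_subset _ _)
  change _ = _ • symbTerm t α (F.face a).1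
  rw [symbTerm_of_symb, Finsupp.smul_single, Finsupp.smul_single, smul_eq_mul, monomial_mul,
    smul_monomial, tsub_add_tsub_cancel hα hle, one_mul, smul_eq_mul, mul_one]

theorem diff_diff_symbTerm {t : ℕ} {α : V →₀ ℕ} (F : Symb I (t + 2)) (hα : lcmExp F.1 ≤ α) :
    diff I t (diff I (t + 1) (symbTerm (t + 2) α F.1)) = 0 := by
  have key : ∀ a ∈ F.1, diff I t ((-1 : K) ^ (F.1.filter (· < a)).card •
      symbTerm (t + 1) α (F.1.erase a)) = ∑ b ∈ F.1.erase a,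
        ((-1 : K) ^ (F.1.filter (· < a)).card * (-1) ^ ((F.1.erase a).filter (· < b)).card) •
          symbTerm t α ((F.1.erase a).erase b) := by
    intro a ha
    have := diff_symbTerm (F.face ⟨a, ha⟩)
      ((lcmExp_mono (Finset.erase_subset _ _)).trans hα)
    rw [LinearMap.map_smul_of_tower]
    refine (congrArg _ this).trans ?_
    rw [Finset.smul_sum]
    exact Finset.sum_congr rfl fun b _ => by rw [smul_smul]; rfl
  rw [diff_symbTerm F hα, map_sum, Finset.sum_congr rfl key,
    Finset.sum_sigma' F.1 (fun a => F.1.erase a)]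
  -- Erasing a then b cancels against erasing b then a.
  refine Finset.sum_involution (fun x _ => ⟨x.2, x.1⟩) ?_ ?_ ?_ ?_
  · rintro ⟨a, b⟩ h
    simp only [Finset.mem_sigma, Finset.mem_erase] at h
    obtain ⟨ha, hba, hb⟩ := h
    simp only
    rw [Finset.erase_right_comm (a := b), ← add_smul]
    rcases lt_or_gt_of_ne hba with hlt | hlt
    · rw [add_comm, sign_erase_swap hb hlt, zero_smul]
    · rw [sign_erase_swap ha hlt, zero_smul]
  · rintro ⟨a, b⟩ h _ heq
    simp only [Finset.mem_sigma, Finset.mem_erase] at h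
    exact h.2.1 (congrArg Sigma.fst heq)
  · rintro ⟨a, b⟩ h
    simp only [Finset.mem_sigma, Finset.mem_erase] at h ⊢
    exact ⟨h.2.2, h.2.1.symm, h.1⟩
  · rintro ⟨a, b⟩ _
    rfl

/-- The elements `symbTerm t α F` with lcm F dividing x^α span L^t over K. Linearity is over K
because the homotopy is not R-linear: its apex depends on α. -/
theorem symb_lhom_ext {t : ℕ} {N : Type*} [AddCommGroup N] [Module K N]
    {f g : LMod I t →ₗ[K] N}
    (h : ∀ (α : V →₀ ℕ) (F : Symb I t), lcmExp F.1 ≤ α →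
      f (symbTerm t α F.1) = g (symbTerm t α F.1)) : f = g := by
  refine Finsupp.lhom_ext' fun F => (basisMonomials V K).ext fun β => ?_
  have := h (β + lcmExp F.1) F le_add_self
  rw [symbTerm_of_symb, add_tsub_cancel_right] at this
  simpa using this

theorem diff_comp_diff (t : ℕ) (x : LMod I (t + 2)) : diff I t (diff I (t + 1) x) = 0 := by
  have : (diff I t).restrictScalars K ∘ₗ (diff I (t + 1)).restrictScalars K = 0 :=
    symb_lhom_ext fun α F hα => diff_diff_symbTerm F hα
  exact LinearMap.congr_fun this x

/-! ### The cone homotopy and exactness in positive degrees -/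

/-- `q` is the first generator dividing `x^α`. -/
def IsApex (α : V →₀ ℕ) (q : MinGen I) : Prop :=
  q.exponent ≤ α ∧ ∀ p : MinGen I, p.exponent ≤ α → q ≤ p

theorem IsApex.eq {α : V →₀ ℕ} {p q : MinGen I} (hp : IsApex α p) (hq : IsApex α q) : p = q :=
  le_antisymm (hp.2 q hq.1) (hq.2 p hp.1)

theorem exists_isApex [Finite (MinGen I)] {α : V →₀ ℕ} {p : MinGen I} (hp : p.exponent ≤ α) :
    ∃ q : MinGen I, IsApex α q := by
  obtain ⟨q, hq, hmin⟩ := Set.exists_min_image {p : MinGen I | p.exponent ≤ α} id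
    (Set.toFinite _) ⟨p, hp⟩
  exact ⟨q, hq, hmin⟩

theorem IsApex.le_of_mem {α : V →₀ ℕ} {q a : MinGen I} (hq : IsApex α q)
    {F : Finset (MinGen I)} (hF : lcmExp F ≤ α) (ha : a ∈ F) : q ≤ a :=
  hq.2 a ((exponent_le_lcmExp ha).trans hF)

theorem IsApex.lcmExp_insert_le {α : V →₀ ℕ} {q : MinGen I} (hq : IsApex α q)
    {F : Finset (MinGen I)} (hF : lcmExp F ≤ α) : lcmExp (insert q F) ≤ α := by
  rw [lcmExp, Finset.sup_insert]
  exact sup_le hq.1 hF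

/-- A generator before q dividing the lcm would divide x^α, contrary to the choice of q. For h after
q, the tail starting at h does not see q. -/
theorem IsApex.isAdmissible_insert {α : V →₀ ℕ} {q : MinGen I} (hq : IsApex α q)
    {F : Finset (MinGen I)} (hF : lcmExp F ≤ α) (hadm : IsAdmissible F) :
    IsAdmissible (insert q F) := by
  rintro h hh ⟨i, hi, hhi⟩ p hp hle
  have hqh : q ≤ h := hq.le_of_mem (hq.lcmExp_insert_le hF) hh
  rcases hqh.eq_or_lt with rfl | hqh
  · exact absurd (hq.2 p (hle.trans ((lcmExp_mono (Finset.filter_subset _ _)).trans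
      (hq.lcmExp_insert_le hF)))) (not_le.2 hp)
  · have hhF : h ∈ F := Finset.mem_of_mem_insert_of_ne hh hqh.ne'
    have hiF : i ∈ F := Finset.mem_of_mem_insert_of_ne hi (hqh.trans hhi).ne'
    rw [Finset.filter_insert, if_neg (not_le.2 hqh)] at hle
    exact hadm h hhF ⟨i, hiF, hhi⟩ p hp hle

open Classical in
/-- The contracting homotopy which, in multidegree `α`, is the cone with apex the first generator
dividing `x^α`. -/
def cone (I : Ideal (MvPolynomial V K)) [LinearOrder (MinGen I)] (t : ℕ) :
    LMod I t →ₗ[K] LMod I (t + 1) :=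
  Finsupp.lsum K fun F => (basisMonomials V K).constr K fun β =>
    if h : ∃ q : MinGen I, IsApex (β + lcmExp F.1) q then
      if h.choose ∈ F.1 then 0 else symbTerm (t + 1) (β + lcmExp F.1) (insert h.choose F.1)
    -- With finitely many generators this occurs only for the empty symbol, since any entry of F
    -- divides x^α.
    else 0

theorem cone_symbTerm {t : ℕ} {α : V →₀ ℕ} (F : Symb I t) (hα : lcmExp F.1 ≤ α)
    {q : MinGen I} (hq : IsApex α q) :
    cone I t (symbTerm t α F.1) =
      if q ∈ F.1 then 0 else symbTerm (t + 1) α (insert q F.1) := by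
  classical
  have h : ∃ q : MinGen I, IsApex α q := ⟨q, hq⟩
  rw [symbTerm_of_symb, cone, Finsupp.lsum_single]
  refine (congrArg _ (congrFun (coe_basisMonomials V K) _).symm).trans ?_
  rw [Module.Basis.constr_basis]
  simp only [tsub_add_cancel_of_le hα]
  rw [dif_pos h, h.choose_spec.eq hq]

/-- The symbol obtained by adjoining the apex. -/
def IsApex.insertSymb {α : V →₀ ℕ} {q : MinGen I} (hq : IsApex α q) {t : ℕ} (F : Symb I t)
    (hα : lcmExp F.1 ≤ α) (hqF : q ∉ F.1) : Symb I (t + 1) :=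
  ⟨insert q F.1, hq.isAdmissible_insert hα F.2.1, by
    rw [Finset.card_insert_of_notMem hqF, F.2.2]⟩

theorem IsApex.diff_symbTerm_insert {α : V →₀ ℕ} {q : MinGen I} (hq : IsApex α q) {t : ℕ}
    (F : Symb I t) (hα : lcmExp F.1 ≤ α) (hqF : q ∉ F.1) :
    diff I t (symbTerm (t + 1) α (insert q F.1)) = symbTerm t α F.1 -
      ∑ a ∈ F.1, (-1 : K) ^ (F.1.filter (· < a)).card • symbTerm t α (insert q (F.1.erase a)) := by
  have hlt : ∀ a ∈ F.1, q < a := fun a ha =>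
    lt_of_le_of_ne (hq.le_of_mem hα ha) fun h => hqF (h ▸ ha)
  refine (diff_symbTerm (hq.insertSymb F hα hqF) (hq.lcmExp_insert_le hα)).trans ?_
  change ∑ a ∈ insert q F.1, (-1 : K) ^ ((insert q F.1).filter (· < a)).card •
    symbTerm t α ((insert q F.1).erase a) = _
  rw [Finset.sum_insert hqF, Finset.erase_insert hqF, sub_eq_add_neg, ← Finset.sum_neg_distrib]
  congr 1
  · rw [Finset.filter_insert, if_neg (lt_irrefl q), Finset.filter_false_of_mem
      fun a ha => not_lt.2 (hlt a ha).le]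
    simp
  · refine Finset.sum_congr rfl fun a ha => ?_
    rw [Finset.filter_insert, if_pos (hlt a ha), Finset.card_insert_of_notMem (by simp [hqF]),
      Finset.erase_insert_of_ne (hlt a ha).ne, pow_succ, mul_neg_one, neg_smul]

/-- If q lies in F, only the face omitting q has a nonzero cone, which is F with sign +1 because q
comes first. Otherwise the boundary of the cone over F is F minus the cone over the boundary of F.
-/
theorem homotopy_symbTerm {t : ℕ} {α : V →₀ ℕ} (F : Symb I (t + 1)) (hα : lcmExp F.1 ≤ α)
    {q : MinGen I} (hq : IsApex α q) :
    diff I (t + 1) (cone I (t + 1) (symbTerm (t + 1) α F.1)) +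
      cone I t (diff I t (symbTerm (t + 1) α F.1)) = symbTerm (t + 1) α F.1 := by
  have hcone : ∀ a ∈ F.1, cone I t ((-1 : K) ^ (F.1.filter (· < a)).card •
      symbTerm t α (F.1.erase a)) = (-1 : K) ^ (F.1.filter (· < a)).card •
        if q ∈ F.1.erase a then 0 else symbTerm (t + 1) α (insert q (F.1.erase a)) := by
    intro a ha
    rw [map_smul]
    exact congrArg _ (cone_symbTerm (F.face ⟨a, ha⟩)
      ((lcmExp_mono (Finset.erase_subset _ _)).trans hα) hq)
  rw [cone_symbTerm F hα hq, diff_symbTerm F hα, map_sum, Finset.sum_congr rfl hcone]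
  by_cases hqF : q ∈ F.1
  · rw [if_pos hqF, map_zero, zero_add, Finset.sum_eq_single_of_mem q hqF]
    · rw [if_neg (Finset.notMem_erase _ _), Finset.insert_erase hqF,
        Finset.filter_false_of_mem fun a ha => not_lt.2 (hq.le_of_mem hα ha)]
      simp
    · intro a _ ha
      rw [if_pos (Finset.mem_erase.2 ⟨ha.symm, hqF⟩), smul_zero]
  · rw [if_neg hqF, hq.diff_symbTerm_insert F hα hqF, Finset.sum_congr rfl fun a _ => congrArg _
      (if_neg fun h => hqF (Finset.mem_of_mem_erase h)), sub_add_cancel]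

theorem diff_cone_add_cone_diff [Finite (MinGen I)] (t : ℕ) (x : LMod I (t + 1)) :
    diff I (t + 1) (cone I (t + 1) x) + cone I t (diff I t x) = x := by
  have : (diff I (t + 1)).restrictScalars K ∘ₗ cone I (t + 1) +
      cone I t ∘ₗ (diff I t).restrictScalars K = LinearMap.id := by
    refine symb_lhom_ext fun α F hα => ?_
    obtain ⟨a, ha⟩ := Finset.card_pos.1 (Nat.lt_of_lt_of_eq (Nat.succ_pos t) F.2.2.symm)
    obtain ⟨q, hq⟩ := exists_isApex ((exponent_le_lcmExp ha).trans hα)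
    exact homotopy_symbTerm F hα hq
  exact LinearMap.congr_fun this x

theorem exact_diff [Finite (MinGen I)] (t : ℕ) :
    Function.Exact (diff I (t + 1)) (diff I t) := by
  intro x
  constructor
  · intro hx
    have := diff_cone_add_cone_diff t x
    rw [hx, map_zero, add_zero] at this
    exact ⟨_, this⟩
  · rintro ⟨y, rfl⟩
    exact diff_comp_diff t y

/-! ### The augmentation and the minimality criterion -/

/-- The empty symbol. -/
def emptySymb (I : Ideal (MvPolynomial V K)) [LinearOrder (MinGen I)] : Symb I 0 :=
  ⟨∅, by rintro h hh; simp at hh, rfl⟩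

instance : Unique (Symb I 0) where
  default := emptySymb I
  uniq F := Subtype.ext (Finset.card_eq_zero.1 F.2.2)

theorem lmod_zero_eq (x : LMod I 0) : x = Finsupp.single (emptySymb I) (x (emptySymb I)) :=
  Finsupp.unique_single x

theorem aug_apply (x : LMod I 0) : aug I x = Ideal.Quotient.mk I (x (emptySymb I)) := by
  conv_lhs => rw [lmod_zero_eq x]
  rw [aug, Finsupp.linearCombination_single, smul_one_quotient]

theorem single_monomial_eq_symbTerm (α : V →₀ ℕ) :
    Finsupp.single (emptySymb I) (monomial α (1 : K)) = symbTerm 0 α (emptySymb I).1 := by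
  rw [symbTerm_of_symb]
  exact congrArg (fun γ => Finsupp.single (emptySymb I) (monomial γ (1 : K))) (tsub_zero α).symm

/-- The cone over the empty symbol is the vertex q, whose boundary in multidegree α is x^α. -/
theorem diff_cone_single [Finite (MinGen I)] {α : V →₀ ℕ} (h : monomial α (1 : K) ∈ I) :
    diff I 0 (cone I 0 (Finsupp.single (emptySymb I) (monomial α (1 : K)))) =
      Finsupp.single (emptySymb I) (monomial α (1 : K)) := by
  obtain ⟨p, hp⟩ := exists_exponent_le h
  obtain ⟨q, hq⟩ := exists_isApex hp
  have hα : lcmExp (emptySymb I).1 ≤ α := by simp [emptySymb, lcmExp]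
  have hqF : q ∉ (emptySymb I).1 := Finset.notMem_empty q
  rw [single_monomial_eq_symbTerm, cone_symbTerm _ hα hq, if_neg hqF,
    hq.diff_symbTerm_insert _ hα hqF]
  exact sub_zero _

theorem aug_diff (x : LMod I 1) : aug I (diff I 0 x) = 0 := by
  have : aug I ∘ₗ diff I 0 = 0 := by
    refine Finsupp.lhom_ext' fun F => LinearMap.ext_ring ?_
    simp only [diff, aug, LinearMap.comp_apply, Finsupp.lsingle_apply,
      Finsupp.linearCombination_single, one_smul, map_sum, LinearMap.zero_apply]
    refine Finset.sum_eq_zero fun a _ => ?_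
    refine (smul_one_quotient _).trans (Ideal.Quotient.eq_zero_iff_mem.2
      (monomial_mem_of_exponent_le (p := a.1) ?_ _))
    have h0 : (F.face a).1 = ∅ := Finset.card_eq_zero.1 (F.face a).2.2
    rw [h0]
    exact (exponent_le_lcmExp a.2).trans (tsub_zero (lcmExp F.1)).ge
  exact LinearMap.congr_fun this x

theorem exact_aug [Finite (MinGen I)] (hI : IsMonomialIdeal I) :
    Function.Exact (diff I 0) (aug I) := by
  intro x
  constructor
  · intro hx
    rw [aug_apply, Ideal.Quotient.eq_zero_iff_mem] at hx
    refine ⟨cone I 0 x, ?_⟩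
    set f := x (emptySymb I)
    rw [lmod_zero_eq x]
    change diff I 0 (cone I 0 (Finsupp.single _ f)) = Finsupp.single _ f
    -- Every monomial of f lies in the monomial ideal, so each term is lifted separately.
    rw [f.as_sum, Finsupp.single_finsetSum, map_sum, map_sum]
    refine Finset.sum_congr rfl fun α hα => ?_
    have hc : monomial α (coeff α f) = coeff α f • monomial α (1 : K) := by
      rw [smul_monomial, smul_eq_mul, mul_one]
    rw [hc, ← Finsupp.smul_single, map_smul, LinearMap.map_smul_of_tower,
      diff_cone_single (hI.monomial_mem hx hα)]
  · rintro ⟨y, rfl⟩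
    exact aug_diff y

theorem surjective_aug : Function.Surjective (aug I) := by
  intro y
  obtain ⟨f, rfl⟩ := Ideal.Quotient.mk_surjective y
  exact ⟨Finsupp.single (emptySymb I) f, by rw [aug_apply, Finsupp.single_eq_same]⟩

theorem range_diff_le (t : ℕ)
    (h : ∀ F : Symb I (t + 1), ∀ a ∈ F.1, ¬ a.exponent ≤ lcmExp (F.1.erase a)) :
    LinearMap.range (diff I t) ≤
      Ideal.span (Set.range (X : V → MvPolynomial V K)) • (⊤ : Submodule _ (LMod I t)) := by
  rw [diff, Finsupp.range_linearCombination, Submodule.span_le]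
  rintro _ ⟨F, rfl⟩
  refine Submodule.sum_mem _ fun a _ => ?_
  have hne : lcmExp F.1 - lcmExp (F.face a).1 ≠ 0 := fun h0 =>
    h F a.1 a.2 ((exponent_le_lcmExp a.2).trans (tsub_eq_zero_iff_le.1 h0))
  rw [← mul_one (monomial _ _), ← smul_eq_mul, ← Finsupp.smul_single]
  exact Submodule.smul_mem_smul (monomial_mem_span_X hne _) Submodule.mem_top

/-- The Lyubeznik resolution is always exact; it is minimal as soon as no entry of an admissible
symbol divides the least common multiple of the other entries. -/
theorem lyubeznikResolutionIsMinimal_of [Finite (MinGen I)] (hI : IsMonomialIdeal I)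
    (h : ∀ F : Finset (MinGen I), IsAdmissible F → ∀ a ∈ F,
      ¬ a.exponent ≤ lcmExp (F.erase a)) : LyubeznikResolutionIsMinimal I where
  free _ := inferInstance
  finite t := by
    have : Finite (Symb I t) := Subtype.finite
    infer_instance
  exact := exact_diff
  exact_zero := exact_aug hI
  surjective := surjective_aug
  minimal t := range_diff_le t fun F a ha => h F.1 F.2.1 a ha

end Resolution

end MonomialIdeal

/-! ### Covers and admissibility -/

section Generators

variable {I : Ideal (MvPolynomial V K)}

theorem MinGen.eq_of_exponent_le {a b : MinGen I} (h : a.exponent ≤ b.exponent) : a = b :=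
  Subtype.ext (le_antisymm h (b.2.2 a.2.1 h))

theorem MinGen.eq_of_exponent_eq {a b : MinGen I} (h : a.exponent = b.exponent) : a = b :=
  Subtype.ext h

theorem exists_le_exponent_apply {A : Finset (MinGen I)} {v : V} {n : ℕ} (hn : 0 < n)
    (h : n ≤ lcmExp A v) : ∃ b ∈ A, n ≤ b.exponent v := by
  classical
  induction A using Finset.induction_on with
  | empty => exact absurd h (not_le.2 hn)
  | insert a A _ ih =>
    rw [lcmExp, Finset.sup_insert, Finsupp.sup_apply, le_sup_iff] at h
    rcases h with h | h
    · exact ⟨a, Finset.mem_insert_self _ _, h⟩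
    · obtain ⟨b, hb, hle⟩ := ih h
      exact ⟨b, Finset.mem_insert_of_mem hb, hle⟩

/-- Three distinct generators, the first of which divides the least common multiple of the other
two, form an `E`-minimal cover. -/
theorem isEMinimalCover_of_le_sup {a b c : MinGen I} {C : Finset (MinGen I)}
    (hab : a ≠ b) (hac : a ≠ c) (hC : ∀ x, x ∈ C ↔ x = a ∨ x = b ∨ x = c)
    (h : a.exponent ≤ b.exponent ⊔ c.exponent) : IsEMinimalCover a C := by
  classical
  refine ⟨⟨(hC a).2 (Or.inl rfl), h.trans (sup_le ?_ ?_)⟩, ?_⟩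
  · exact exponent_le_lcmExp (by simp [hC, hab.symm])
  · exact exponent_le_lcmExp (by simp [hC, hac.symm])
  · rintro D hD ⟨haD, hle⟩
    obtain ⟨x, hxC, hxD⟩ := Finset.exists_of_ssubset hD
    have key : ∀ y, a ≠ y → (∀ z ∈ D, z = a ∨ z = y) → False := by
      intro y hy hz
      refine hy (MinGen.eq_of_exponent_le (hle.trans (Finset.sup_le fun z hzD => ?_)))
      simp only [Finset.mem_erase] at hzD
      rw [(hz z hzD.2).resolve_left hzD.1]
    rcases (hC x).1 hxC with rfl | rfl | rfl
    · exact hxD haD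
    · exact key c hac fun z hz => by
        rcases (hC z).1 (hD.1 hz) with h | rfl | h
        · exact Or.inl h
        · exact absurd hz hxD
        · exact Or.inr h
    · exact key b hab fun z hz => by
        rcases (hC z).1 (hD.1 hz) with h | h | rfl
        · exact Or.inl h
        · exact Or.inr h
        · exact absurd hz hxD

/-- If a or c equals b, at most one other generator y remains to cover b. Then b divides y, hence b
= y, and b divides the empty lcm, which is 1. -/
theorem IsEMinimalCover.ne {a b c : MinGen I} {C : Finset (MinGen I)}
    (hC : ∀ x, x ∈ C ↔ x = a ∨ x = b ∨ x = c) (h : IsEMinimalCover b C)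
    (hb : b.exponent ≠ 0) : a ≠ b ∧ c ≠ b := by
  classical
  obtain ⟨⟨-, hle⟩, -⟩ := h
  have key : ∀ y, (∀ z ∈ C, z = b ∨ z = y) → y ≠ b := by
    rintro y hy rfl
    refine hb (le_bot_iff.1 (hle.trans (Finset.sup_le fun z hz => ?_)))
    simp only [Finset.mem_erase] at hz
    exact absurd ((hy z hz.2).elim id id) hz.1
  have key' : ∀ y, (∀ z ∈ C, z = b ∨ z = y) → b.exponent ≤ y.exponent := by
    intro y hy
    refine hle.trans (Finset.sup_le fun z hz => ?_)
    simp only [Finset.mem_erase] at hz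
    rw [(hy z hz.2).resolve_left hz.1]
  constructor
  · rintro rfl
    have hy : ∀ z ∈ C, z = a ∨ z = c := fun z hz => by rcases (hC z).1 hz with h | h | h <;> tauto
    exact key c hy (MinGen.eq_of_exponent_le (key' c hy)).symm
  · rintro rfl
    have hy : ∀ z ∈ C, z = c ∨ z = a := fun z hz => by rcases (hC z).1 hz with h | h | h <;> tauto
    exact key a hy (MinGen.eq_of_exponent_le (key' a hy)).symm

/-- The tail starting at the smaller of y and z contains both, and x precedes it. -/
theorem IsAdmissible.not_le_sup [LinearOrder (MinGen I)] {F : Finset (MinGen I)}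
    (hF : IsAdmissible F) {x y z : MinGen I} (hy : y ∈ F) (hz : z ∈ F) (hxy : x < y)
    (hxz : x < z) (hyz : y ≠ z) : ¬ x.exponent ≤ y.exponent ⊔ z.exponent := by
  intro hle
  wlog h : y < z generalizing y z
  · exact this hz hy hxz hxy hyz.symm (by rwa [sup_comm])
      (lt_of_le_of_ne (not_lt.1 h) hyz.symm)
  · refine hF y hy ⟨z, hz, h⟩ x hxy (hle.trans (sup_le ?_ ?_))
    · exact exponent_le_lcmExp (Finset.mem_filter.2 ⟨hy, le_rfl⟩)
    · exact exponent_le_lcmExp (Finset.mem_filter.2 ⟨hz, h.le⟩)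

theorem IsAdmissible.not_triangle [LinearOrder (MinGen I)] {F : Finset (MinGen I)}
    (hF : IsAdmissible F) {x y z : MinGen I} (hx : x ∈ F) (hy : y ∈ F) (hz : z ∈ F)
    (hxy : x ≠ y) (hxz : x ≠ z) (hyz : y ≠ z) (hx' : x.exponent ≤ y.exponent ⊔ z.exponent)
    (hy' : y.exponent ≤ x.exponent ⊔ z.exponent) :
    ¬ z.exponent ≤ x.exponent ⊔ y.exponent := by
  intro hz'
  rcases lt_or_gt_of_ne hxy with h | h
  · rcases lt_or_gt_of_ne hxz with h' | h'
    · exact hF.not_le_sup hy hz h h' hyz hx'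
    · exact hF.not_le_sup hx hy h' (h'.trans h) hxy hz'
  · rcases lt_or_gt_of_ne hyz with h' | h'
    · exact hF.not_le_sup hx hz h h' hxz hy'
    · exact hF.not_le_sup hx hy (h'.trans h) h' hxy hz'

end Generators

/-! ### Edge ideals: minimality from the order -/

section EdgeIdeal

variable (G : SimpleGraph V)

theorem edgeIdeal_eq_span_monomial :
    edgeIdeal K G = Ideal.span ((fun m => monomial m (1 : K)) ''
      {m | ∃ i j, G.Adj i j ∧ m = Finsupp.single i 1 + Finsupp.single j 1}) := by
  rw [edgeIdeal]
  congr 1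
  ext f
  constructor
  · rintro ⟨i, j, h, rfl⟩
    exact ⟨_, ⟨i, j, h, rfl⟩, by simp [X, monomial_mul]⟩
  · rintro ⟨_, ⟨i, j, h, rfl⟩, rfl⟩
    exact ⟨i, j, h, by simp [X, monomial_mul]⟩

theorem isMonomialIdeal_edgeIdeal : IsMonomialIdeal (edgeIdeal K G) :=
  ⟨_, edgeIdeal_eq_span_monomial G⟩

variable {G}

theorem exists_adj (m : MinGen (edgeIdeal K G)) :
    ∃ i j, G.Adj i j ∧ m.exponent = Finsupp.single i 1 + Finsupp.single j 1 := by
  have hm := (edgeIdeal_eq_span_monomial (K := K) G).le (monomial_exponent_mem m)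
  rw [mem_ideal_span_monomial_image] at hm
  obtain ⟨_, ⟨i, j, h, rfl⟩, hle⟩ := hm m.exponent (by
    classical
    rw [mem_support_iff, coeff_monomial, if_pos rfl]
    exact one_ne_zero)
  refine ⟨i, j, h, le_antisymm (m.2.2 ?_ hle) hle⟩
  rw [edgeIdeal_eq_span_monomial]
  exact Ideal.subset_span ⟨_, ⟨i, j, h, rfl⟩, rfl⟩

theorem finite_minGen_edgeIdeal [Finite V] : Finite (MinGen (edgeIdeal K G)) := by
  choose i j _ h using exists_adj (K := K) (G := G)
  refine Finite.of_injective (fun m => (i m, j m)) fun m n hmn => ?_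
  obtain ⟨hi, hj⟩ := Prod.mk.inj hmn
  exact MinGen.eq_of_exponent_eq (by rw [h m, h n, hi, hj])

theorem exists_adj_of_one_le {m : MinGen (edgeIdeal K G)} {i : V} (h : 1 ≤ m.exponent i) :
    ∃ r, G.Adj r i ∧ m.exponent = Finsupp.single r 1 + Finsupp.single i 1 := by
  classical
  obtain ⟨r, s, hrs, hm⟩ := exists_adj m
  rw [hm, Finsupp.add_apply, Finsupp.single_apply, Finsupp.single_apply] at h
  by_cases hs : s = i
  · exact ⟨r, hs ▸ hrs, by rw [hm, hs]⟩
  · have hr : r = i := by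
      by_contra hr
      simp [hr, hs] at h
    exact ⟨s, hr ▸ hrs.symm, by rw [hm, hr, add_comm]⟩

theorem adj_of_exponent_eq {m : MinGen (edgeIdeal K G)} {i j : V}
    (h : m.exponent = Finsupp.single i 1 + Finsupp.single j 1) : G.Adj i j := by
  classical
  obtain ⟨r, hr, hm⟩ := exists_adj_of_one_le (m := m) (i := j) (by simp [h])
  rw [h, add_left_inj] at hm
  rwa [Finsupp.single_left_injective one_ne_zero hm]

theorem single_add_single_le_sup {x y z w : V} (hxy : x ≠ y) :
    (Finsupp.single x 1 + Finsupp.single y 1 : V →₀ ℕ) ≤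
      (Finsupp.single z 1 + Finsupp.single x 1) ⊔ (Finsupp.single w 1 + Finsupp.single y 1) := by
  classical
  intro v
  simp only [Finsupp.add_apply, Finsupp.sup_apply, Finsupp.single_apply]
  split_ifs <;> first | omega | simp_all

/-- No entry of an admissible symbol divides the least common multiple of the other entries. -/
theorem not_le_lcmExp_erase [LinearOrder (MinGen (edgeIdeal K G))] (hG : MiddleEdgeFirst K G)
    {F : Finset (MinGen (edgeIdeal K G))} (hF : IsAdmissible F) {a : MinGen (edgeIdeal K G)}
    (ha : a ∈ F) : ¬ a.exponent ≤ lcmExp (F.erase a) := by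
  classical
  intro hle
  obtain ⟨i, j, hij, hae⟩ := exists_adj a
  -- The variables x_i and x_j must each be supplied by another entry of F.
  obtain ⟨b, hb, hbi⟩ := exists_le_exponent_apply (v := i) one_pos
    ((show 1 ≤ a.exponent i by simp [hae]).trans (hle i))
  obtain ⟨c, hc, hcj⟩ := exists_le_exponent_apply (v := j) one_pos
    ((show 1 ≤ a.exponent j by simp [hae]).trans (hle j))
  obtain ⟨hba, hbF⟩ := Finset.mem_erase.1 hb
  obtain ⟨hca, hcF⟩ := Finset.mem_erase.1 hc
  obtain ⟨r, hri, hbe⟩ := exists_adj_of_one_le hbi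
  obtain ⟨s, hsj, hce⟩ := exists_adj_of_one_le hcj
  have hac : a.exponent ≤ b.exponent ⊔ c.exponent := by
    rw [hae, hbe, hce]
    exact single_add_single_le_sup hij.ne
  have hbc : b ≠ c := by
    rintro rfl
    rw [sup_idem] at hac
    exact hba (MinGen.eq_of_exponent_le hac).symm
  by_cases hrs : r = s
  -- The edges a, b, c form a triangle.
  · subst hrs
    refine hF.not_triangle ha hbF hcF hba.symm hca.symm hbc hac ?_ ?_
    · rw [hae, hbe, hce, add_comm (Finsupp.single r 1) (Finsupp.single i 1),
        add_comm (Finsupp.single i 1) (Finsupp.single j 1),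
        add_comm (Finsupp.single r 1) (Finsupp.single j 1)]
      exact single_add_single_le_sup hri.ne'
    · rw [hae, hbe, hce, add_comm (Finsupp.single r 1) (Finsupp.single j 1),
        add_comm (Finsupp.single r 1) (Finsupp.single i 1)]
      exact single_add_single_le_sup hsj.ne'
  · have hC : ∀ x, x ∈ ({b, a, c} : Finset (MinGen (edgeIdeal K G))) ↔ x = b ∨ x = a ∨ x = c := by
      simp
    have := hG r i j s b a c {b, a, c} hrs hbe hae (by rw [hce, add_comm]) hC
      (isEMinimalCover_of_le_sup hba.symm hca.symm (fun x => (hC x).trans or_left_comm) hac)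
    exact hF.not_le_sup hbF hcF this.1 this.2 hbc hac

theorem lyubeznikResolutionIsMinimal_of_middleEdgeFirst [Finite V]
    [LinearOrder (MinGen (edgeIdeal K G))] (hG : MiddleEdgeFirst K G) :
    LyubeznikResolutionIsMinimal (edgeIdeal K G) :=
  have := finite_minGen_edgeIdeal (K := K) (G := G)
  lyubeznikResolutionIsMinimal_of (isMonomialIdeal_edgeIdeal G) fun _ hF _ ha =>
    not_le_lcmExp_erase hG hF ha

/-! ### Existence of an order with middle edges first -/

/-- The edge `ij` is the middle edge of a path `r - i - j - s`. -/
def IsMiddleEdge (G : SimpleGraph V) (i j : V) : Prop :=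
  ∃ r s, r ≠ s ∧ r ≠ j ∧ s ≠ i ∧ G.Adj r i ∧ G.Adj i j ∧ G.Adj j s

theorem IsMiddleEdge.symm {i j : V} : IsMiddleEdge G i j → IsMiddleEdge G j i := by
  rintro ⟨r, s, h1, h2, h3, h4, h5, h6⟩
  exact ⟨s, r, h1.symm, h3, h2, h6.symm, h5.symm, h4.symm⟩

theorem not_adj_chain (hpath : ∀ (u v : V) (p : G.Walk u v), p.IsPath → p.length < 4)
    {a b c d e : V} (hab : G.Adj a b) (hbc : G.Adj b c) (hcd : G.Adj c d) (hde : G.Adj d e)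
    (h : [a, b, c, d, e].Nodup) : False := by
  have := hpath a e (.cons hab (.cons hbc (.cons hcd (.cons hde .nil))))
    (by rw [SimpleGraph.Walk.isPath_def]; simpa using h)
  simp at this

theorem not_adj_four_cycle (hcycle : ∀ (u : V) (c : G.Walk u u), c.IsCycle → c.length < 4)
    {a b c d : V} (hab : G.Adj a b) (hbc : G.Adj b c) (hcd : G.Adj c d) (hda : G.Adj d a)
    (hac : a ≠ c) (hbd : b ≠ d) : False := by
  have := hcycle a (.cons hab (.cons hbc (.cons hcd (.cons hda .nil)))) (by
    rw [SimpleGraph.Walk.cons_isCycle_iff, SimpleGraph.Walk.isPath_def]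
    simp [hab.ne, hab.ne', hbc.ne, hcd.ne, hda.ne, hac, hac.symm, hbd])
  simp at this

/-- A path t - r - i - u around the end edge ri would combine with r - i - j - s into a four-cycle
or a path with four edges. -/
theorem IsMiddleEdge.not_isMiddleEdge
    (hpath : ∀ (u v : V) (p : G.Walk u v), p.IsPath → p.length < 4)
    (hcycle : ∀ (u : V) (c : G.Walk u u), c.IsCycle → c.length < 4)
    {r i j s : V} (hrs : r ≠ s) (hrj : r ≠ j) (hsi : s ≠ i) (hri : G.Adj r i) (hij : G.Adj i j)
    (hjs : G.Adj j s) : ¬ IsMiddleEdge G r i := by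
  rintro ⟨t, u, htu, hti, hur, htr, -, hiu⟩
  have := hri.ne
  have := hij.ne
  have := hjs.ne
  have := htr.ne
  have := hiu.ne
  by_cases hts : t = s
  · subst hts
    -- The cycle r, i, j, s.
    exact not_adj_four_cycle hcycle hri hij hjs htr hrj hsi.symm
  by_cases htj : t = j
  · subst htj
    -- Here r, i, j is a triangle. If u = s there is the cycle r, i, s, j; otherwise the path u, i,
    -- r, j, s.
    by_cases hus : u = s
    · subst hus
      exact not_adj_four_cycle hcycle hri hiu hjs.symm htr hrs (by assumption)
    · exact not_adj_chain hpath hiu.symm hri.symm htr.symm hjs (by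
        simp only [List.nodup_cons, List.mem_cons, List.not_mem_nil]; grind)
  -- The path t, r, i, j, s.
  · exact not_adj_chain hpath htr hri hij hjs (by
      simp only [List.nodup_cons, List.mem_cons, List.not_mem_nil]; grind)

/-- The generator is the middle edge of a path with three edges. -/
def IsMiddleGen (m : MinGen (edgeIdeal K G)) : Prop :=
  ∃ i j, m.exponent = Finsupp.single i 1 + Finsupp.single j 1 ∧ IsMiddleEdge G i j

theorem single_add_single_eq {i j k l : V}
    (h : (Finsupp.single i 1 + Finsupp.single j 1 : V →₀ ℕ) =
      Finsupp.single k 1 + Finsupp.single l 1) : i = k ∧ j = l ∨ i = l ∧ j = k := by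
  rw [Finsupp.single_add_single_eq_single_add_single one_ne_zero one_ne_zero] at h
  simpa using h

theorem isMiddleGen_iff {m : MinGen (edgeIdeal K G)} {i j : V}
    (h : m.exponent = Finsupp.single i 1 + Finsupp.single j 1) :
    IsMiddleGen m ↔ IsMiddleEdge G i j := by
  constructor
  · rintro ⟨k, l, hkl, hm⟩
    rcases single_add_single_eq (hkl.symm.trans h) with ⟨rfl, rfl⟩ | ⟨rfl, rfl⟩
    · exact hm
    · exact hm.symm
  · exact fun hm => ⟨i, j, h, hm⟩

theorem exists_linearOrder_lt_of_not {α : Type*} (p : α → Prop) :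
    ∃ _ : LinearOrder α, ∀ x y : α, p x → ¬ p y → x < y := by
  classical
  let _ : LinearOrder α := linearOrderOfSTO WellOrderingRel
  -- Since `false < true`, elements satisfying p come first; the second coordinate breaks ties.
  let f : α → Bool ×ₗ α := fun x => toLex (decide (¬ p x), x)
  have hf : Function.Injective f := fun x y h => (Prod.mk.inj (toLex.injective h)).2
  refine ⟨LinearOrder.lift' f hf, fun x y hx hy => ?_⟩
  change f x < f y
  rw [Prod.Lex.lt_iff]
  left
  simp [f, hx, hy]

theorem exists_middleEdgeFirst
    (hpath : ∀ (u v : V) (p : G.Walk u v), p.IsPath → p.length < 4)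
    (hcycle : ∀ (u : V) (c : G.Walk u u), c.IsCycle → c.length < 4) :
    ∃ _ : LinearOrder (MinGen (edgeIdeal K G)), MiddleEdgeFirst K G := by
  obtain ⟨inst, hlt⟩ := exists_linearOrder_lt_of_not (IsMiddleGen (K := K) (G := G))
  refine ⟨inst, fun r i j s a b c C hrs ha hb hc hC hmin => ?_⟩
  have hri := adj_of_exponent_eq ha
  have hij := adj_of_exponent_eq hb
  have hjs := adj_of_exponent_eq hc
  obtain ⟨hab, hcb⟩ := hmin.ne hC (by
    rw [hb]
    exact fun h => by simpa using DFunLike.congr_fun h i)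
  have hrj : r ≠ j := by
    rintro rfl
    exact hab (MinGen.eq_of_exponent_eq (by rw [ha, hb, add_comm]))
  have hsi : s ≠ i := by
    rintro rfl
    exact hcb (MinGen.eq_of_exponent_eq (by rw [hb, hc, add_comm]))
  have hbm : IsMiddleGen b := ⟨i, j, hb, r, s, hrs, hrj, hsi, hri, hij, hjs⟩
  refine ⟨hlt b a hbm ?_, hlt b c hbm ?_⟩
  · rw [isMiddleGen_iff ha]
    exact IsMiddleEdge.not_isMiddleEdge hpath hcycle hrs hrj hsi hri hij hjs
  · rw [isMiddleGen_iff hc]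
    -- The other end edge is treated by reversing the path.
    exact fun h => IsMiddleEdge.not_isMiddleEdge hpath hcycle hrs.symm hsi hrj hjs.symm hij.symm
      hri.symm h.symm

end EdgeIdeal

end Lyubeznik

end

theorem mainTheorem11 {V K : Type*} [Finite V] [Field K] (G : SimpleGraph V)
    (hpath : ∀ (u v : V) (p : G.Walk u v), p.IsPath → p.length < 4)
    (hcycle : ∀ (u : V) (c : G.Walk u u), c.IsCycle → c.length < 4) :
    Lyubeznik.IsLyubeznikIdeal (Lyubeznik.edgeIdeal K G) ∧
      (∃ _ : LinearOrder (Lyubeznik.MinGen (Lyubeznik.edgeIdeal K G)),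
        Lyubeznik.MiddleEdgeFirst K G) ∧
      ∀ _ : LinearOrder (Lyubeznik.MinGen (Lyubeznik.edgeIdeal K G)),
        Lyubeznik.MiddleEdgeFirst K G →
          Lyubeznik.LyubeznikResolutionIsMinimal (Lyubeznik.edgeIdeal K G) := by
  have hmin := fun (_ : LinearOrder (Lyubeznik.MinGen (Lyubeznik.edgeIdeal K G)))
    (h : Lyubeznik.MiddleEdgeFirst K G) =>
      Lyubeznik.lyubeznikResolutionIsMinimal_of_middleEdgeFirst h
  obtain ⟨inst, h⟩ := Lyubeznik.exists_middleEdgeFirst (K := K) hpath hcycle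
  exact ⟨⟨Lyubeznik.isMonomialIdeal_edgeIdeal G, inst, hmin inst h⟩, ⟨inst, h⟩, hmin⟩
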